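/- All graphs are finite, simple, undirected and connected. Let $\rho(G)$ denote the largest eigenvalue of the adjacency matrix of $G$; let $G_1+G_2$ and $G_1\vee G_2$ denote the disjoint union and the join of $G_1$ and $G_2$, and let $mK_1$ denote the graph with $m$ vertices and no edges. A $\{K_2,\{C_t : t\ge 3\}\}$-factor of a graph $H$ (here $H$ need not be connected) is a spanning subgraph of $H$ each of whose connected components is isomorphic to $K_2$ or to a cycle $C_t$ with $t\ge 3$. Let $G$ be a graph of order $n\ge 3$. (1) If $n\ge 7$ or $n\in\{3,5\}$, if $\rho(G)\ge\rho\bigl(K_1\vee(K_{n-2}+K_1)\bigr)$, and if $G$ is not isomorphic to $K_1\vee(K_{n-2}+K_1)$, then $G-v$ has a $\{K_2,\{C_t : t\ge 3\}\}$-factor for every vertex $v$ of $G$. (2) If $n\in\{4,6\}$, if $\rho(G)\ge\rho\bigl(K_{n/2}\vee \tfrac n2 K_1\bigr)$, and if $G$ is not isomorphic to $K_{n/2}\vee \tfrac n2 K_1$, then $G-v$ has a $\{K_2,\{C_t : t\ge 3\}\}$-factor for every vertex $v$ of $G$. -/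

import Mathlib

namespace SpectralFactor

/-- The join `G ∨ H`: the disjoint union of `G` and `H` together with all edges between them. -/
def join {V W : Type*} (G : SimpleGraph V) (H : SimpleGraph W) : SimpleGraph (V ⊕ W) :=
  SimpleGraph.sum G H ⊔ completeBipartiteGraph V W

/-- The graph `K_1 ∨ (K_{n-2} + K_1)`, meant for `n ≥ 3`. -/
def pendantGraph (n : ℕ) : SimpleGraph (Fin 1 ⊕ (Fin (n - 2) ⊕ Fin 1)) :=
  join (⊤ : SimpleGraph (Fin 1)) (SimpleGraph.sum (⊤ : SimpleGraph (Fin (n - 2))) (⊤ : SimpleGraph (Fin 1)))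

/-- The graph `K_m ∨ m K_1`. -/
def balancedGraph (m : ℕ) : SimpleGraph (Fin m ⊕ Fin m) :=
  join (⊤ : SimpleGraph (Fin m)) (⊥ : SimpleGraph (Fin m))

open Classical in
/-- The adjacency spectral radius: the largest (real) eigenvalue of the adjacency matrix. -/
noncomputable def rho {V : Type*} [Fintype V] (G : SimpleGraph V) : ℝ :=
  sSup {x : ℝ | Module.End.HasEigenvalue (Matrix.toLin' (G.adjMatrix ℝ)) x}

open Classical in
/-- On a nonempty vertex set, the largest eigenvalue is attained. -/
theorem rho_isGreatest {V : Type*} [Fintype V] [Nonempty V] (G : SimpleGraph V) :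
    IsGreatest {x : ℝ | Module.End.HasEigenvalue (Matrix.toLin' (G.adjMatrix ℝ)) x} (rho G) := by
  have hS : {x : ℝ | Module.End.HasEigenvalue (Matrix.toLin' (G.adjMatrix ℝ)) x}
      = spectrum ℝ (G.adjMatrix ℝ) := by
    ext x
    rw [Set.mem_ofPred_eq, Module.End.hasEigenvalue_iff_mem_spectrum, Matrix.spectrum_toLin']
  have hA : (G.adjMatrix ℝ).IsHermitian := by
    rw [Matrix.IsHermitian, Matrix.conjTranspose_eq_transpose_of_trivial]
    exact G.transpose_adjMatrix
  unfold rho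
  rw [hS]
  have hfin : (spectrum ℝ (G.adjMatrix ℝ)).Finite := Matrix.finite_spectrum _
  have hne : (spectrum ℝ (G.adjMatrix ℝ)).Nonempty :=
    ⟨_, hA.eigenvalues_mem_spectrum_real (Classical.arbitrary V)⟩
  exact ⟨hne.csSup_mem hfin, fun x hx => le_csSup hfin.bddAbove hx⟩

/-- `G` has an `ℋ`-factor: a spanning subgraph `F` of `G` (a graph `F ≤ G` on the same vertex set)
each of whose connected components is isomorphic to a member of the family `ℋ`. -/
def HasFactor {V : Type*} (G : SimpleGraph V) (ℋ : Set (Σ m : ℕ, SimpleGraph (Fin m))) : Prop :=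
  ∃ F : SimpleGraph V, F ≤ G ∧
    ∀ c : F.ConnectedComponent, ∃ H ∈ ℋ, Nonempty (c.toSimpleGraph ≃g H.2)

/-- The family `{K_2, {C_t : t ≥ 3}}`. -/
def edgeOrCycle : Set (Σ m : ℕ, SimpleGraph (Fin m)) :=
  {H | H = ⟨2, (⊤ : SimpleGraph (Fin 2))⟩ ∨ ∃ t : ℕ, 3 ≤ t ∧ H = ⟨t, SimpleGraph.cycleGraph t⟩}

/-- `G - v`: the graph obtained from `G` by deleting the vertex `v` and its incident edges. -/
abbrev deleteVertex {V : Type*} (G : SimpleGraph V) (v : V) :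
    SimpleGraph ({v}ᶜ : Set V) :=
  G.induce {v}ᶜ

end SpectralFactor

/-! An injective map on the vertices of `G - v` sending each vertex to a neighbour is a permutation,
and its cycles form a factor into edges and cycles. If there is no factor, Hall's condition
therefore fails, and the vertices of a Hall violator that are isolated inside it form an independent
set with too few neighbours. Adding `v` to the neighbours and trimming the independent set gives
disjoint sets `T`, `I` of equal size `s ≥ 1` with `N(I) ⊆ T`, so `G` is a spanning subgraph of `K_s
∨ (K_{n-2s} + s K_1)`.

Spectral radii are compared through positive weights constant on the three classes: a positive
supersolution for `μ` gives `ρ ≤ μ`, and `μ ≤ ρ` forces equality (`nbrSum_eq_of_le_rho`), hence no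
missing edge. In case (1), `s = 1` is the extremal graph, with `ρ > n - 2`, while `s ≥ 2` gives `ρ ≤
n - 2`. In case (2), a rational number separates `s = n/2` from smaller `s`. -/

namespace SpectralFactor

/-! ### Eigenvalues and positive supersolutions -/

open Classical in
/-- The weighted sum of `x` over the neighbours of `v`. -/
noncomputable def nbrSum {V : Type*} [Fintype V] (G : SimpleGraph V) (x : V → ℝ) (v : V) : ℝ :=
  ∑ w, if G.Adj v w then x w else 0

open Classical in
theorem hasEigenvalue_iff_nbrSum {V : Type*} [Fintype V] (G : SimpleGraph V) (μ : ℝ) :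
    Module.End.HasEigenvalue (Matrix.toLin' (G.adjMatrix ℝ)) μ ↔
      ∃ x : V → ℝ, x ≠ 0 ∧ ∀ v, nbrSum G x v = μ * x v := by
  have key (x : V → ℝ) : Matrix.toLin' (G.adjMatrix ℝ) x = μ • x ↔
      ∀ v, nbrSum G x v = μ * x v := by
    rw [funext_iff]
    refine forall_congr' fun v => ?_
    simp [nbrSum, Matrix.toLin'_apply, Matrix.mulVec, dotProduct, SimpleGraph.adjMatrix_apply]
  constructor
  · intro h
    obtain ⟨x, hx⟩ := h.exists_hasEigenvector
    exact ⟨x, hx.2, (key x).1 hx.apply_eq_smul⟩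
  · rintro ⟨x, hx, h⟩
    exact Module.End.hasEigenvalue_of_hasEigenvector
      ⟨Module.End.mem_eigenspace_iff.2 ((key x).2 h), hx⟩

theorem le_rho {V : Type*} [Fintype V] (G : SimpleGraph V) {μ : ℝ} {x : V → ℝ} (hx : x ≠ 0)
    (h : ∀ v, nbrSum G x v = μ * x v) : μ ≤ rho G := by
  obtain ⟨v, -⟩ := Function.ne_iff.1 hx
  have : Nonempty V := ⟨v⟩
  exact (rho_isGreatest G).2 ((hasEigenvalue_iff_nbrSum G μ).2 ⟨x, hx, h⟩)

theorem exists_nbrSum_eq_rho {V : Type*} [Fintype V] [Nonempty V] (G : SimpleGraph V) :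
    ∃ x : V → ℝ, x ≠ 0 ∧ ∀ v, nbrSum G x v = rho G * x v :=
  (hasEigenvalue_iff_nbrSum G _).1 (rho_isGreatest G).1

theorem nbrSum_lt {V : Type*} [Fintype V] (G : SimpleGraph V) {x y : V → ℝ}
    (h : ∀ v, x v ≤ y v) {v w : V} (hvw : G.Adj v w) (hw : x w < y w) :
    nbrSum G x v < nbrSum G y v := by
  refine Finset.sum_lt_sum (fun w _ => ?_) ⟨w, Finset.mem_univ w, by simpa [hvw] using hw⟩
  split_ifs
  · exact h w
  · exact le_rfl

theorem nbrSum_const_mul {V : Type*} [Fintype V] (G : SimpleGraph V) (t : ℝ) (x : V → ℝ) (v : V) :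
    nbrSum G (fun w => t * x w) v = t * nbrSum G x v := by
  simp [nbrSum, Finset.mul_sum]

theorem abs_nbrSum_le {V : Type*} [Fintype V] (G : SimpleGraph V) (x : V → ℝ) (v : V) :
    |nbrSum G x v| ≤ nbrSum G (fun w => |x w|) v := by
  refine (Finset.abs_sum_le_sum_abs _ _).trans (le_of_eq (Finset.sum_congr rfl fun w _ => ?_))
  split_ifs <;> simp

/-- A positive supersolution whose parameter does not exceed the spectral radius of a connected
graph is a solution. -/
theorem nbrSum_eq_of_le_rho {V : Type*} [Fintype V] {G : SimpleGraph V} (hG : G.Connected)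
    {μ : ℝ} {x : V → ℝ} (hx : ∀ v, 0 < x v) (h : ∀ v, nbrSum G x v ≤ μ * x v)
    (hμ : μ ≤ rho G) (v : V) : nbrSum G x v = μ * x v ∧ μ = rho G := by
  have := hG.nonempty
  obtain ⟨z, hz0, hz⟩ := exists_nbrSum_eq_rho G
  have hsub (v : V) : rho G * |z v| ≤ nbrSum G (fun w => |z w|) v :=
    calc rho G * |z v| ≤ |rho G| * |z v| := by gcongr; exact le_abs_self _
      _ = |nbrSum G z v| := by rw [hz, abs_mul]
      _ ≤ _ := abs_nbrSum_le G z v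
  -- `t` is the least multiplier with `|z| ≤ t x`; the two functions touch at `i`, and `hstep`
  -- spreads contact along edges.
  obtain ⟨i, hi⟩ := Finite.exists_max fun v => |z v| / x v
  set t := |z i| / x i with ht
  have hle (v : V) : |z v| ≤ t * x v := (div_le_iff₀ (hx v)).1 (hi v)
  have ht0 : 0 < t := by
    obtain ⟨j, hj⟩ := Function.ne_iff.1 hz0
    exact (div_pos (abs_pos.2 hj) (hx j)).trans_le (hi j)
  have hup (v : V) : nbrSum G (fun w => t * x w) v ≤ μ * (t * x v) := by
    rw [nbrSum_const_mul]; nlinarith [h v]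
  have hstep (v w : V) (hvw : G.Adj v w) (hv : |z v| = t * x v) : |z w| = t * x w := by
    refine (hle w).antisymm (le_of_not_gt fun hlt => ?_)
    have h1 := nbrSum_lt G (x := fun w => |z w|) (y := fun w => t * x w) hle hvw hlt
    have h2 := hsub v
    have h3 := hup v
    rw [hv] at h2
    have h4 : μ * (t * x v) ≤ rho G * (t * x v) := by
      have := mul_pos ht0 (hx v)
      gcongr
    linarith
  have hwalk {v w : V} (p : G.Walk v w) : |z w| = t * x w → |z v| = t * x v := by
    induction p with
    | nil => exact id
    | cons hadj _ ih => exact fun h0 => hstep _ _ hadj.symm (ih h0)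
  have hall (v : V) : |z v| = t * x v := by
    obtain ⟨p⟩ := hG.preconnected v i
    exact hwalk p (by rw [ht, div_mul_cancel₀ _ (hx i).ne'])
  have h2 := hsub v
  have h3 := hup v
  rw [funext hall, nbrSum_const_mul, hall] at h2
  rw [nbrSum_const_mul] at h3
  have hp := mul_pos ht0 (hx v)
  have h4 : μ * (t * x v) ≤ rho G * (t * x v) := by gcongr
  refine ⟨mul_left_cancel₀ ht0.ne' (by linarith), mul_right_cancel₀ hp.ne' (by linarith)⟩

theorem rho_le_of_supersolution {V : Type*} [Fintype V] {G : SimpleGraph V} (hG : G.Connected)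
    {μ : ℝ} {x : V → ℝ} (hx : ∀ v, 0 < x v) (h : ∀ v, nbrSum G x v ≤ μ * x v) : rho G ≤ μ := by
  by_contra! hlt
  obtain ⟨v⟩ := hG.nonempty
  exact hlt.ne (nbrSum_eq_of_le_rho hG hx h hlt.le v).2

/-! ### Spectral comparison with a spanning supergraph -/

section Embedding

variable {V W : Type*} [Fintype V] [Fintype W] {G : SimpleGraph V} {P : SimpleGraph W}

theorem nbrSum_comp_equiv_le (e : V ≃ W) (hom : ∀ a b, G.Adj a b → P.Adj (e a) (e b))
    {x : W → ℝ} (hx : ∀ w, 0 < x w) (v : V) :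
    nbrSum G (x ∘ e) v ≤ nbrSum P x (e v) := by
  unfold nbrSum
  rw [← e.sum_comp]
  refine Finset.sum_le_sum fun w _ => ?_
  by_cases h : G.Adj v w
  · simp [h, hom _ _ h]
  · simp only [h, if_false]
    split_ifs
    exacts [(hx _).le, le_rfl]

theorem nbrSum_comp_equiv_lt (e : V ≃ W) (hom : ∀ a b, G.Adj a b → P.Adj (e a) (e b))
    {x : W → ℝ} (hx : ∀ w, 0 < x w) {v w : V} (h : ¬ G.Adj v w) (h' : P.Adj (e v) (e w)) :
    nbrSum G (x ∘ e) v < nbrSum P x (e v) := by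
  unfold nbrSum
  rw [← e.sum_comp]
  refine Finset.sum_lt_sum (fun w _ => ?_) ⟨w, Finset.mem_univ w, by simpa [h, h'] using hx _⟩
  by_cases h : G.Adj v w
  · simp [h, hom _ _ h]
  · simp only [h, if_false]
    split_ifs
    exacts [(hx _).le, le_rfl]

theorem rho_le_of_spanning (hG : G.Connected) (e : V ≃ W)
    (hom : ∀ a b, G.Adj a b → P.Adj (e a) (e b)) {μ : ℝ} {x : W → ℝ} (hx : ∀ w, 0 < x w)
    (h : ∀ w, nbrSum P x w ≤ μ * x w) : rho G ≤ μ :=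
  rho_le_of_supersolution hG (x := x ∘ e) (fun v => hx (e v)) fun v =>
    (nbrSum_comp_equiv_le e hom hx v).trans (h (e v))

/-- A connected graph which is a spanning subgraph of `P` and whose spectral radius is at least a
positive eigenvalue parameter of `P` is isomorphic to `P`. -/
theorem nonempty_iso_of_spanning (hG : G.Connected) (e : V ≃ W)
    (hom : ∀ a b, G.Adj a b → P.Adj (e a) (e b)) {μ : ℝ} {x : W → ℝ} (hx : ∀ w, 0 < x w)
    (h : ∀ w, nbrSum P x w ≤ μ * x w) (hμ : μ ≤ rho G) : Nonempty (G ≃g P) := by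
  refine ⟨⟨e, fun {a b} => ⟨fun hP => ?_, hom a b⟩⟩⟩
  by_contra hab
  have h1 := nbrSum_comp_equiv_lt e hom hx hab hP
  have h2 : nbrSum G (x ∘ e) a = μ * x (e a) := (nbrSum_eq_of_le_rho hG (x := x ∘ e) (fun v => hx (e v)) (fun v =>
    (nbrSum_comp_equiv_le e hom hx v).trans (h (e v))) hμ a).1
  have h3 := h (e a)
  linarith

end Embedding

/-! ### Permutations, Hall's theorem and factors -/

section Factor

variable {V : Type*}

/-- The graph joining every vertex to its image under a permutation. -/
def permGraph (σ : Equiv.Perm V) : SimpleGraph V :=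
  SimpleGraph.fromRel fun a b => σ a = b

theorem permGraph_adj (σ : Equiv.Perm V) {a b : V} :
    (permGraph σ).Adj a b ↔ a ≠ b ∧ (σ a = b ∨ σ b = a) := Iff.rfl

theorem permGraph_reachable_iff [Finite V] (σ : Equiv.Perm V) {a b : V} :
    (permGraph σ).Reachable a b ↔ ∃ k : ℕ, (σ ^ k) a = b := by
  constructor
  · rintro ⟨p⟩
    suffices σ.SameCycle a b by
      obtain ⟨k, -, hk⟩ := this.exists_pow_eq'
      exact ⟨k, hk⟩
    induction p with
    | nil => exact Equiv.Perm.SameCycle.refl _ _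
    | cons h _ ih =>
      refine Equiv.Perm.SameCycle.trans ?_ ih
      rcases ((permGraph_adj σ).1 h).2 with h | h
      · exact ⟨1, by simpa using h⟩
      · exact Equiv.Perm.SameCycle.symm ⟨1, by simpa using h⟩
  · rintro ⟨k, rfl⟩
    induction k with
    | zero => exact SimpleGraph.Reachable.refl _
    | succ k ih =>
      by_cases h : (σ ^ k) a = (σ ^ (k + 1)) a
      · rwa [← h]
      · refine ih.trans (SimpleGraph.Adj.reachable ?_)
        exact (permGraph_adj σ).2 ⟨h, Or.inl (by rw [pow_succ', Equiv.Perm.mul_apply])⟩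

open Function in
/-- The component of a non-fixed point in the graph of a permutation is a cycle, where the cycle of
length two is an edge. -/
theorem permGraph_component [Finite V] (σ : Equiv.Perm V) {a : V} (ha : σ a ≠ a) :
    ∃ t : ℕ, 2 ≤ t ∧ Nonempty
      (((permGraph σ).connectedComponentMk a).toSimpleGraph ≃g SimpleGraph.cycleGraph t) := by
  have hper : a ∈ periodicPts σ := σ.injective.mem_periodicPts a
  obtain ⟨t, ht⟩ : ∃ t, t + 2 = minimalPeriod σ a := by
    have h1 := minimalPeriod_pos_of_mem_periodicPts hper
    have h2 : minimalPeriod σ a ≠ 1 := fun h => ha (minimalPeriod_eq_one_iff_isFixedPt.1 h)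
    exact ⟨minimalPeriod σ a - 2, by omega⟩
  have hinj {i j : ℕ} (hi : i < t + 2) (hj : j < t + 2) :
      σ^[i] a = σ^[j] a ↔ i = j :=
    iterate_eq_iterate_iff_of_lt_minimalPeriod (ht ▸ hi) (ht ▸ hj)
  have hmod (i : ℕ) : σ^[i % (t + 2)] a = σ^[i] a := by
    rw [ht]; exact iterate_mod_minimalPeriod_eq
  let f : Fin (t + 2) → ((permGraph σ).connectedComponentMk a) := fun i =>
    ⟨σ^[i] a, SimpleGraph.ConnectedComponent.sound
      ((permGraph_reachable_iff σ).2 ⟨i, by rw [Equiv.Perm.iterate_eq_pow]⟩).symm⟩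
  have hf : Bijective f := by
    constructor
    · intro i j hij
      exact Fin.ext ((hinj i.2 j.2).1 (congrArg Subtype.val hij))
    · rintro ⟨b, hb⟩
      obtain ⟨k, hk⟩ := (permGraph_reachable_iff σ).1 (SimpleGraph.ConnectedComponent.exact hb).symm
      refine ⟨⟨k % (t + 2), Nat.mod_lt _ (by omega)⟩, Subtype.ext ?_⟩
      change σ^[k % (t + 2)] a = b
      rw [hmod, Equiv.Perm.iterate_eq_pow, hk]
  -- Addition in `Fin (t + 2)` wraps around, so the closing edge of the cycle needs no separate
  -- case.
  have hstep (i j : Fin (t + 2)) : σ (σ^[i] a) = σ^[j] a ↔ j = i + 1 := by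
    rw [← iterate_succ_apply' σ i a, ← hmod, hinj (Nat.mod_lt _ (by omega)) j.2, Fin.ext_iff,
      Fin.val_add]
    simp [eq_comm]
  refine ⟨t + 2, by omega, ⟨SimpleGraph.Iso.symm ⟨Equiv.ofBijective f hf, fun {i j} => ?_⟩⟩⟩
  change (permGraph σ).Adj (σ^[i] a) (σ^[j] a) ↔ _
  rw [permGraph_adj, hstep, hstep, SimpleGraph.cycleGraph_adj, ne_eq, hinj i.2 j.2, sub_eq_iff_eq_add,
    sub_eq_iff_eq_add, add_comm 1, add_comm 1, or_comm]
  refine ⟨fun h => h.2, fun h => ⟨fun hij => ?_, h⟩⟩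
  rw [Fin.ext hij] at h
  simp at h

/-- Since `G` has no loops, `σ` has no fixed points: its 2-cycles give copies of `K_2` and its
longer cycles give cycle graphs. -/
theorem hasFactor_of_perm [Finite V] {G : SimpleGraph V} (σ : Equiv.Perm V)
    (hσ : ∀ v, G.Adj v (σ v)) : HasFactor G edgeOrCycle := by
  refine ⟨permGraph σ, fun a b h => ?_, fun c => ?_⟩
  · rcases ((permGraph_adj σ).1 h).2 with rfl | rfl
    · exact hσ a
    · exact (hσ b).symm
  · induction c using SimpleGraph.ConnectedComponent.ind with
    | h a =>
    obtain ⟨t, ht, hiso⟩ := permGraph_component σ (hσ a).ne'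
    rcases ht.eq_or_lt with rfl | ht
    · exact ⟨_, Or.inl rfl, SimpleGraph.cycleGraph_two_eq_top ▸ hiso⟩
    · exact ⟨_, Or.inr ⟨t, ht, rfl⟩, hiso⟩

open Classical in
/-- A graph without a factor into edges and cycles has an independent set with too few
neighbours. -/
theorem exists_independent_of_not_hasFactor [Fintype V] {G : SimpleGraph V}
    (h : ¬ HasFactor G edgeOrCycle) :
    ∃ I : Finset V, (∀ a ∈ I, ∀ b ∈ I, ¬ G.Adj a b) ∧
      (Finset.univ.filter fun b => ∃ a ∈ I, G.Adj a b).card < I.card := by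
  have hall : ¬ ∀ A : Finset V, A.card ≤ (Finset.univ.filter fun b => ∃ a ∈ A, G.Adj a b).card := by
    rw [Fintype.all_card_le_filter_rel_iff_exists_injective]
    rintro ⟨f, hf, hadj⟩
    exact h (hasFactor_of_perm (Equiv.ofBijective f hf.bijective_of_finite) hadj)
  push Not at hall
  obtain ⟨A, hA⟩ := hall
  let I := A.filter fun a => ∀ b ∈ A, ¬ G.Adj a b
  let N := Finset.univ.filter fun b => ∃ a ∈ I, G.Adj a b
  refine ⟨I, fun a ha b hb => (Finset.mem_filter.1 ha).2 b (Finset.mem_filter.1 hb).1, ?_⟩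
  change N.card < I.card
  -- `A \ I` and `N` are disjoint parts of the neighbourhood of `A`, which is smaller than `A`;
  -- cancelling `A \ I` leaves `|N| < |I|`.
  have hdisj : Disjoint (A \ I) N := by
    rw [Finset.disjoint_left]
    intro b hb hbN
    obtain ⟨a, ha, hab⟩ := (Finset.mem_filter.1 hbN).2
    exact (Finset.mem_filter.1 ha).2 b (Finset.mem_sdiff.1 hb).1 hab
  have hsub : (A \ I) ∪ N ⊆ Finset.univ.filter fun b => ∃ a ∈ A, G.Adj a b := by
    intro b hb
    refine Finset.mem_filter.2 ⟨Finset.mem_univ b, ?_⟩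
    rcases Finset.mem_union.1 hb with hb | hb
    · obtain ⟨hbA, hbI⟩ := Finset.mem_sdiff.1 hb
      by_contra! hno
      exact hbI (Finset.mem_filter.2 ⟨hbA, fun c hc hbc => hno c hc hbc.symm⟩)
    · obtain ⟨a, ha, hab⟩ := (Finset.mem_filter.1 hb).2
      exact ⟨a, (Finset.mem_filter.1 ha).1, hab⟩
  have h1 := Finset.card_le_card hsub
  rw [Finset.card_union_of_disjoint hdisj] at h1
  have hIA : I ⊆ A := Finset.filter_subset _ _
  have h2 := Finset.card_sdiff_add_card_eq_card hIA
  omega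

/-- If some vertex-deleted subgraph has no factor into edges and cycles, then a nonempty set `T`
contains every neighbour of a disjoint set `I` of the same size. -/
theorem exists_disjoint_of_not_hasFactor [Fintype V] {G : SimpleGraph V} {v : V}
    (h : ¬ HasFactor (deleteVertex G v) edgeOrCycle) :
    ∃ T I : Finset V, 1 ≤ T.card ∧ T.card = I.card ∧ Disjoint T I ∧
      ∀ a ∈ I, ∀ b, G.Adj a b → b ∈ T := by
  classical
  obtain ⟨J, hind, hcard⟩ := exists_independent_of_not_hasFactor h
  set N := Finset.univ.filter fun b => ∃ a ∈ J, (deleteVertex G v).Adj a b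
  have hNJ : N.card < J.card := by convert hcard
  -- Restoring `v` adds at most `v` to the neighbourhood. The strict inequality pays for it and
  -- makes `T` nonempty.
  let T : Finset V := insert v (N.map (Function.Embedding.subtype _))
  have hT : T.card = N.card + 1 := by
    rw [Finset.card_insert_of_notMem, Finset.card_map]
    simp
  have hle : T.card ≤ (J.map (Function.Embedding.subtype _)).card := by
    rw [Finset.card_map]; omega
  obtain ⟨I, hIJ, hI⟩ := Finset.exists_subset_card_eq hle
  refine ⟨T, I, by omega, hI.symm, ?_, ?_⟩
  · rw [Finset.disjoint_right]
    intro a ha haT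
    obtain ⟨a, haJ, rfl⟩ := Finset.mem_map.1 (hIJ ha)
    rcases Finset.mem_insert.1 haT with hav | haN
    · exact a.2 hav
    · obtain ⟨b, hbN, hb⟩ := Finset.mem_map.1 haN
      obtain rfl : b = a := Subtype.ext hb
      obtain ⟨c, hc, hcb⟩ := (Finset.mem_filter.1 hbN).2
      exact hind c hc b haJ hcb
  · intro a ha b hab
    obtain ⟨a, haJ, rfl⟩ := Finset.mem_map.1 (hIJ ha)
    by_cases hbv : b = v
    · exact hbv ▸ Finset.mem_insert_self _ _
    · exact Finset.mem_insert_of_mem (Finset.mem_map.2 ⟨⟨b, hbv⟩,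
        Finset.mem_filter.2 ⟨Finset.mem_univ _, a, haJ, hab⟩, rfl⟩)

end Factor

/-! ### The graphs `K_s ∨ (K_r + s K_1)` -/

section Extremal

/-- The graph `K_s ∨ (K_r + s K_1)`. -/
def extremalGraph (s r : ℕ) : SimpleGraph (Fin s ⊕ (Fin r ⊕ Fin s)) :=
  join ⊤ (SimpleGraph.sum ⊤ ⊥)

/-- The function on `K_s ∨ (K_r + s K_1)` with value `1` on `K_s`, `b` on `K_r`, `c` on `s K_1`. -/
def classWeight (s r : ℕ) (b c : ℝ) : Fin s ⊕ (Fin r ⊕ Fin s) → ℝ :=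
  Sum.elim (fun _ => 1) (Sum.elim (fun _ => b) fun _ => c)

theorem classWeight_pos {s r : ℕ} {b c : ℝ} (hb : 0 < b) (hc : 0 < c) (w) :
    0 < classWeight s r b c w := by
  rcases w with _ | _ | _
  exacts [one_pos, hb, hc]

theorem sum_ite_eq_zero_else {m : ℕ} (i : Fin m) (c : ℝ) [∀ j, Decidable (i = j)] :
    ∑ j, (if i = j then 0 else c) = ((m : ℝ) - 1) * c := by
  rw [Finset.sum_congr rfl (g := fun j => c - if j = i then c else 0)]
  · rw [Finset.sum_sub_distrib]
    simp [sub_mul]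
  · intro j _
    by_cases h : i = j
    · simp [h]
    · simp [h, Ne.symm h]

section Adj
variable {s r : ℕ}

@[simp] theorem extremalGraph_adj_inl_inl (i j : Fin s) :
    (extremalGraph s r).Adj (.inl i) (.inl j) ↔ i ≠ j := by
  simp [extremalGraph, join]

@[simp] theorem extremalGraph_adj_inl_inr (i : Fin s) (j : Fin r ⊕ Fin s) :
    (extremalGraph s r).Adj (.inl i) (.inr j) := by
  simp [extremalGraph, join]

@[simp] theorem extremalGraph_adj_inr_inl (i : Fin r ⊕ Fin s) (j : Fin s) :
    (extremalGraph s r).Adj (.inr i) (.inl j) := by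
  simp [extremalGraph, join]

@[simp] theorem extremalGraph_adj_middle (i j : Fin r) :
    (extremalGraph s r).Adj (.inr (.inl i)) (.inr (.inl j)) ↔ i ≠ j := by
  simp [extremalGraph, join]

@[simp] theorem extremalGraph_adj_middle_right (i : Fin r) (j : Fin s) :
    ¬ (extremalGraph s r).Adj (.inr (.inl i)) (.inr (.inr j)) := by
  simp [extremalGraph, join]

@[simp] theorem extremalGraph_adj_right_inr (i : Fin s) (j : Fin r ⊕ Fin s) :
    ¬ (extremalGraph s r).Adj (.inr (.inr i)) (.inr j) := by
  rcases j with j | j <;> simp [extremalGraph, join]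

end Adj

/-- The partition is equitable, so one condition per class suffices. `R` will be `=` for
eigenvectors and `≤` for supersolutions; `hr` is guarded because the middle class may be empty. -/
theorem forall_nbrSum_classWeight {s r : ℕ} {b c μ : ℝ} {R : ℝ → ℝ → Prop}
    (hs : R ((s - 1 : ℝ) + r * b + s * c) μ) (hr : 0 < r → R (s + (r - 1 : ℝ) * b) (μ * b))
    (hc : R s (μ * c)) (w) :
    R (nbrSum (extremalGraph s r) (classWeight s r b c) w) (μ * classWeight s r b c w) := by
  rcases w with i | i | i
  · simpa [nbrSum, classWeight, Fintype.sum_sum_type, sum_ite_eq_zero_else, ← add_assoc] using hs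
  · simpa [nbrSum, classWeight, Fintype.sum_sum_type, sum_ite_eq_zero_else] using hr i.pos
  · simpa [nbrSum, classWeight, Fintype.sum_sum_type] using hc

theorem le_rho_extremalGraph {s r : ℕ} (h0 : 1 ≤ s) {b c μ : ℝ} (hb : 0 < b) (hc : 0 < c)
    (h1 : (s - 1 : ℝ) + r * b + s * c = μ) (h2 : 0 < r → s + (r - 1 : ℝ) * b = μ * b)
    (h3 : s = μ * c) : μ ≤ rho (extremalGraph s r) := by
  refine le_rho _ (x := classWeight s r b c) (fun h => ?_)
    (forall_nbrSum_classWeight (R := fun a b => a = b) h1 h2 h3)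
  exact (classWeight_pos hb hc _).ne' (congrFun h (.inl ⟨0, h0⟩))

theorem rho_le_of_spanning_extremalGraph {V : Type*} [Fintype V] {G : SimpleGraph V}
    (hG : G.Connected) {s r : ℕ} (e : V ≃ Fin s ⊕ (Fin r ⊕ Fin s))
    (hom : ∀ a b, G.Adj a b → (extremalGraph s r).Adj (e a) (e b)) {b c μ : ℝ}
    (hb : 0 < b) (hc : 0 < c)
    (h1 : (s - 1 : ℝ) + r * b + s * c ≤ μ) (h2 : 0 < r → s + (r - 1 : ℝ) * b ≤ μ * b)
    (h3 : s ≤ μ * c) : rho G ≤ μ :=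
  rho_le_of_spanning hG e hom (classWeight_pos hb hc)
    (forall_nbrSum_classWeight (R := fun a b => a ≤ b) h1 h2 h3)

/-- Up to adding edges, a graph in which a set `T` contains all neighbours of a disjoint set `I` of
the same size is `K_s ∨ (K_r + s K_1)`. -/
theorem exists_spanning_extremalGraph {V : Type*} [Fintype V] {G : SimpleGraph V}
    {T I : Finset V} (hTI : T.card = I.card) (hdisj : Disjoint T I)
    (h : ∀ a ∈ I, ∀ b, G.Adj a b → b ∈ T) :
    2 * T.card ≤ Fintype.card V ∧
    ∃ e : V ≃ Fin T.card ⊕ (Fin (Fintype.card V - 2 * T.card) ⊕ Fin T.card),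
      ∀ a b, G.Adj a b → (extremalGraph _ _).Adj (e a) (e b) := by
  classical
  have hU := Finset.card_union_of_disjoint hdisj
  have hle := Finset.card_le_univ (T ∪ I)
  have hC := Finset.card_compl (T ∪ I)
  refine ⟨by omega, ?_⟩
  let eT : {a // a ∈ T} ≃ Fin T.card := T.equivFin
  let eI : {a // a ∈ I} ≃ Fin T.card := I.equivFinOfCardEq hTI.symm
  let eC : {a // a ∈ (T ∪ I)ᶜ} ≃ Fin (Fintype.card V - 2 * T.card) :=
    (T ∪ I)ᶜ.equivFinOfCardEq (by omega)
  have hmem {a : V} (h1 : a ∉ T) (h2 : a ∉ I) : a ∈ (T ∪ I)ᶜ := by simp [h1, h2]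
  let f : V → Fin T.card ⊕ (Fin (Fintype.card V - 2 * T.card) ⊕ Fin T.card) := fun a =>
    if h1 : a ∈ T then .inl (eT ⟨a, h1⟩)
    else if h2 : a ∈ I then .inr (.inr (eI ⟨a, h2⟩))
    else .inr (.inl (eC ⟨a, hmem h1 h2⟩))
  have hinj : Function.Injective f := by
    intro a b hab
    simp only [f] at hab
    split_ifs at hab <;> simp at hab <;> exact hab
  have hf : Function.Bijective f := by
    rw [Fintype.bijective_iff_injective_and_card]
    refine ⟨hinj, ?_⟩
    simp only [Fintype.card_sum, Fintype.card_fin]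
    omega
  refine ⟨Equiv.ofBijective f hf, fun a b hab => ?_⟩
  have hne := hinj.ne hab.ne
  -- The target lacks only edges inside `I` and between `I` and the middle class, which `h`
  -- excludes.
  have hIa := fun ha => h a ha b hab
  have hIb := fun hb => h b hb a hab.symm
  change (extremalGraph _ _).Adj (f a) (f b)
  simp only [f] at hne ⊢
  split_ifs at hne ⊢ <;> simp_all
end Extremal

/-! ### Eigenvalues of the two extremal graphs -/

theorem pendantGraph_eq (n : ℕ) : pendantGraph n = extremalGraph 1 (n - 2) := by
  rw [pendantGraph, extremalGraph, Subsingleton.elim (⊤ : SimpleGraph (Fin 1)) ⊥]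

/-- The isomorphism between `K_m ∨ m K_1` and `K_m ∨ (K_0 + m K_1)`. -/
def extremalGraphZeroIso (m : ℕ) : extremalGraph m 0 ≃g balancedGraph m where
  toEquiv := Equiv.sumCongr (Equiv.refl _) (Equiv.emptySum _ _)
  map_rel_iff' := by
    rintro (a | a | a) (b | b | b)
    all_goals first | exact a.elim0 | exact b.elim0 | simp [balancedGraph, join]

theorem rho_le_rho_of_iso {V W : Type*} [Fintype V] [Fintype W] [Nonempty V] {G : SimpleGraph V}
    {H : SimpleGraph W} (e : G ≃g H) : rho G ≤ rho H := by
  obtain ⟨x, hx0, hx⟩ := exists_nbrSum_eq_rho G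
  refine le_rho H (x := x ∘ e.symm) (fun h => hx0 (funext fun v => ?_)) fun w => ?_
  · simpa using congrFun h (e v)
  · rw [Function.comp_apply, ← hx]
    unfold nbrSum
    rw [← e.symm.toEquiv.sum_comp]
    refine Finset.sum_congr rfl fun u _ => ?_
    simp only [Function.comp_apply]
    have h : H.Adj w u ↔ G.Adj (e.symm w) (e.symm u) := (e.symm.map_adj_iff).symm
    split_ifs <;> first | rfl | (exfalso; tauto)

/-- The last two equations give `b = 1/(μ-r+1)` and `c = 1/μ`; the first becomes the cubic `p μ =
0`. As `p r = -1` and `p (r+1) ≥ 0`, a root lies above `r`, which will be `n - 2`. -/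
theorem exists_eigenfunction_pendant (r : ℕ) (hr : 1 ≤ r) :
    ∃ μ b c : ℝ, r < μ ∧ 0 < b ∧ 0 < c ∧ r * b + c = μ ∧ 1 + (r - 1) * b = μ * b ∧ 1 = μ * c := by
  have hr' : (1 : ℝ) ≤ r := by exact_mod_cast hr
  let p : ℝ → ℝ := fun x => x ^ 2 * (x - r + 1) - r * x - (x - r + 1)
  have hp : ContinuousOn p (Set.Icc (r : ℝ) (r + 1)) := by fun_prop
  have hp0 : p r < 0 := by simp only [p]; nlinarith
  obtain ⟨μ, ⟨h1, -⟩, h2⟩ := intermediate_value_Icc (by linarith) hp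
    (show (0 : ℝ) ∈ Set.Icc (p r) (p (r + 1)) from ⟨hp0.le, by simp only [p]; nlinarith⟩)
  have h3 : (r : ℝ) < μ := h1.lt_of_ne fun h => by rw [← h] at h2; exact hp0.ne h2
  have h4 : 0 < μ - r + 1 := by linarith
  have h5 : 0 < μ := by linarith
  simp only [p] at h2
  refine ⟨μ, 1 / (μ - r + 1), 1 / μ, h3, by positivity, by positivity, ?_, ?_, ?_⟩
  · field_simp
    linarith
  · field_simp
    ring
  · field_simp

/-- Eliminating `c` leaves the quadratic `p`; `h` says `p l < 0`, placing a root above `l`. -/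
theorem exists_eigenfunction_balanced {m l : ℝ} (hl : 0 < l) (hlm : l ≤ 2 * m)
    (h : l ^ 2 < (m - 1) * l + m ^ 2) :
    ∃ μ c : ℝ, l < μ ∧ 0 < c ∧ (m - 1) + m * c = μ ∧ m = μ * c := by
  let p : ℝ → ℝ := fun x => x ^ 2 - (m - 1) * x - m ^ 2
  have hp : ContinuousOn p (Set.Icc l (2 * m)) := by fun_prop
  have hp0 : p l < 0 := by simp only [p]; linarith
  obtain ⟨μ, ⟨h1, -⟩, h2⟩ := intermediate_value_Icc hlm hp
    (show (0 : ℝ) ∈ Set.Icc (p l) (p (2 * m)) from ⟨hp0.le, by simp only [p]; nlinarith⟩)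
  have h3 : l < μ := h1.lt_of_ne fun h => by rw [← h] at h2; exact hp0.ne h2
  have h5 : 0 < μ := hl.trans h3
  have hm : 0 < m := by linarith
  simp only [p] at h2
  refine ⟨μ, m / μ, h3, by positivity, ?_, ?_⟩
  · field_simp
    linarith
  · field_simp

/-! ### Numerical bounds and conclusion -/

/-- This is the supersolution condition on `K_s` for `μ = n - 2`. It is an equality at `n = 5`, `s =
2`, and fails for `s = n/2` when `n = 4` or `6`. -/
theorem sq_mul_le_of_two_le {s n : ℕ} (hs : 2 ≤ s) (hsn : 2 * s ≤ n) (hn : 7 ≤ n ∨ n = 5) :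
    (s : ℝ) ^ 2 * (2 * s - 1) ≤ (s - 1) * (n - 1) * (n - 2) := by
  have hsn' : (2 * s : ℝ) ≤ n := by exact_mod_cast hsn
  have hn5 : (5 : ℝ) ≤ n := by exact_mod_cast (show 5 ≤ n by omega)
  rcases (show s = 2 ∨ s = 3 ∧ 7 ≤ n ∨ 4 ≤ s by omega) with rfl | ⟨rfl, h7⟩ | h4
  · norm_num
    nlinarith
  · have h7' : (7 : ℝ) ≤ n := by exact_mod_cast h7
    norm_num
    nlinarith
  · have h4' : (4 : ℝ) ≤ s := by exact_mod_cast h4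
    have h1 : (2 * s - 1 : ℝ) * (2 * s - 2) ≤ (n - 1) * (n - 2) :=
      mul_le_mul (by linarith) (by linarith) (by linarith) (by linarith)
    have h2 : (s : ℝ) ^ 2 ≤ 2 * (s - 1) ^ 2 := by nlinarith
    calc (s : ℝ) ^ 2 * (2 * s - 1) ≤ 2 * (s - 1) ^ 2 * (2 * s - 1) := by
          apply mul_le_mul_of_nonneg_right h2; linarith
      _ = (s - 1) * ((2 * s - 1 : ℝ) * (2 * s - 2)) := by ring
      _ ≤ (s - 1) * ((n - 1) * (n - 2)) := mul_le_mul_of_nonneg_left h1 (by linarith)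
      _ = _ := by ring

section Spanning
variable {V : Type*} [Fintype V] {G : SimpleGraph V} {s r n : ℕ}

theorem rho_le_of_spanning_of_two_le (hG : G.Connected) (hs : 2 ≤ s) (hr : n = 2 * s + r)
    (hn : 7 ≤ n ∨ n = 5) (e : V ≃ Fin s ⊕ (Fin r ⊕ Fin s))
    (hom : ∀ a b, G.Adj a b → (extremalGraph s r).Adj (e a) (e b)) : rho G ≤ n - 2 := by
  have key := sq_mul_le_of_two_le hs (by omega) hn
  have hs' : (2 : ℝ) ≤ s := by exact_mod_cast hs
  have hr' : (r : ℝ) = n - 2 * s := by rw [hr]; push_cast; ring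
  have hn5 : (5 : ℝ) ≤ n := by exact_mod_cast (show 5 ≤ n by omega)
  have h1 : (0 : ℝ) < 2 * s - 1 := by linarith
  have h2 : (0 : ℝ) < n - 2 := by linarith
  -- `b` and `c` solve the conditions on `K_r` and `s K_1` with equality for `μ = n - 2`.
  refine rho_le_of_spanning_extremalGraph hG e hom (b := s / (2 * s - 1)) (c := s / (n - 2))
    (by positivity) (by positivity) ?_ (fun _ => le_of_eq ?_) (le_of_eq ?_)
  · rw [hr', ← sub_nonneg]
    have : (n - 2 : ℝ) - ((s - 1 : ℝ) + (n - 2 * s) * (s / (2 * s - 1)) + s * (s / (n - 2))) =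
        ((s - 1) * (n - 1) * (n - 2) - (s : ℝ) ^ 2 * (2 * s - 1)) / ((2 * s - 1) * (n - 2)) := by
      field_simp
      ring
    rw [this]
    exact div_nonneg (by linarith) (by positivity)
  · have hb : (s : ℝ) / (2 * s - 1) * (2 * s - 1) = s := div_mul_cancel₀ _ h1.ne'
    rw [hr']
    linear_combination -hb
  · field_simp

/-- Among the connected spanning subgraphs of the graphs `K_s ∨ (K_{n-2s} + s K_1)`, only
`K_1 ∨ (K_{n-2} + K_1)` attains its spectral radius. -/
theorem nonempty_iso_pendantGraph (hG : G.Connected) (hs : 1 ≤ s) (hr : n = 2 * s + r)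
    (hn : 7 ≤ n ∨ n = 3 ∨ n = 5) (e : V ≃ Fin s ⊕ (Fin r ⊕ Fin s))
    (hom : ∀ a b, G.Adj a b → (extremalGraph s r).Adj (e a) (e b))
    (hρ : rho (pendantGraph n) ≤ rho G) : Nonempty (G ≃g pendantGraph n) := by
  obtain ⟨μ, b, c, hμ, hb, hc, h1, h2, h3⟩ := exists_eigenfunction_pendant (n - 2) (by omega)
  rw [pendantGraph_eq] at hρ ⊢
  have hle : μ ≤ rho (extremalGraph 1 (n - 2)) :=
    le_rho_extremalGraph le_rfl hb hc (by simpa using h1) (by simpa using fun _ => h2)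
      (by simpa using h3)
  rcases hs.eq_or_lt with rfl | hs
  · obtain rfl : r = n - 2 := by omega
    exact nonempty_iso_of_spanning hG e hom (classWeight_pos hb hc)
      (forall_nbrSum_classWeight (R := fun a b => a ≤ b) (by simpa using h1.le)
        (by simpa using fun _ => h2.le) (by simpa using h3.le)) (hle.trans hρ)
  · have := rho_le_of_spanning_of_two_le hG hs hr (by omega) e hom
    rw [Nat.cast_sub (by omega)] at hμ
    push_cast at hμ
    linarith

/-- The value `l` lies below the spectral radius of `K_{n/2} ∨ (n/2) K_1`, about 2.56 for `n = 4`
and 4.16 for `n = 6`. The weights are `b = s/(l-r+1)` and `c = s/l`. -/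
theorem rho_le_of_spanning_of_small (hG : G.Connected) {l : ℝ} (hs : 1 ≤ s) (hr : 1 ≤ r)
    (hn : 2 * s + r = 4 ∧ l = 5 / 2 ∨ 2 * s + r = 6 ∧ l = 41 / 10)
    (e : V ≃ Fin s ⊕ (Fin r ⊕ Fin s))
    (hom : ∀ a b, G.Adj a b → (extremalGraph s r).Adj (e a) (e b)) : rho G ≤ l := by
  obtain ⟨rfl, rfl, rfl⟩ | ⟨rfl, rfl, rfl⟩ | ⟨rfl, rfl, rfl⟩ :
      s = 1 ∧ r = 2 ∧ l = 5 / 2 ∨ s = 1 ∧ r = 4 ∧ l = 41 / 10 ∨ s = 2 ∧ r = 2 ∧ l = 41 / 10 := by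
    rcases hn with ⟨h, rfl⟩ | ⟨h, rfl⟩
    · exact Or.inl ⟨by omega, by omega, rfl⟩
    · rcases (show s = 1 ∨ s = 2 by omega) with rfl | rfl
      · exact Or.inr (Or.inl ⟨rfl, by omega, rfl⟩)
      · exact Or.inr (Or.inr ⟨rfl, by omega, rfl⟩)
  · exact rho_le_of_spanning_extremalGraph hG e hom (b := 2 / 3) (c := 2 / 5)
      (by norm_num) (by norm_num) (by norm_num) (by norm_num) (by norm_num)
  · exact rho_le_of_spanning_extremalGraph hG e hom (b := 10 / 11) (c := 10 / 41)
      (by norm_num) (by norm_num) (by norm_num) (by norm_num) (by norm_num)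
  · exact rho_le_of_spanning_extremalGraph hG e hom (b := 20 / 31) (c := 20 / 41)
      (by norm_num) (by norm_num) (by norm_num) (by norm_num) (by norm_num)

/-- For `n = 4` and `n = 6`, among the connected spanning subgraphs of the graphs
`K_s ∨ (K_{n-2s} + s K_1)`, only `K_{n/2} ∨ (n/2) K_1` attains its spectral radius. -/
theorem nonempty_iso_balancedGraph (hG : G.Connected) (hs : 1 ≤ s) (hr : n = 2 * s + r)
    (hn : n = 4 ∨ n = 6) (e : V ≃ Fin s ⊕ (Fin r ⊕ Fin s))
    (hom : ∀ a b, G.Adj a b → (extremalGraph s r).Adj (e a) (e b))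
    (hρ : rho (balancedGraph (n / 2)) ≤ rho G) : Nonempty (G ≃g balancedGraph (n / 2)) := by
  obtain ⟨m, l, hm, hnl, hl, hlm, h⟩ : ∃ (m : ℕ) (l : ℝ), n = 2 * m ∧
      (n = 4 ∧ l = 5 / 2 ∨ n = 6 ∧ l = 41 / 10) ∧
      0 < l ∧ l ≤ 2 * m ∧ l ^ 2 < (m - 1) * l + m ^ 2 := by
    rcases hn with rfl | rfl
    · exact ⟨2, 5 / 2, by norm_num⟩
    · exact ⟨3, 41 / 10, by norm_num⟩
  obtain ⟨μ, c, hμ, hc, h1, h2⟩ := exists_eigenfunction_balanced hl hlm h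
  have hnm : n / 2 = m := by omega
  have hm1 : 1 ≤ m := by omega
  rw [hnm] at hρ ⊢
  have : Nonempty (Fin m ⊕ (Fin 0 ⊕ Fin m)) := ⟨.inl ⟨0, hm1⟩⟩
  have hle : μ ≤ rho G :=
    (le_rho_extremalGraph hm1 one_pos hc (by simpa using h1) (fun h => absurd h (lt_irrefl 0))
      h2).trans ((rho_le_rho_of_iso (extremalGraphZeroIso m)).trans hρ)
  rcases r.eq_zero_or_pos with rfl | hr0
  · obtain rfl : s = m := by omega
    obtain ⟨f⟩ := nonempty_iso_of_spanning hG e hom (classWeight_pos one_pos hc)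
      (forall_nbrSum_classWeight (R := fun a b => a ≤ b) (by simpa using h1.le)
        (fun h => absurd h (lt_irrefl 0)) h2.le) hle
    exact ⟨f.trans (extremalGraphZeroIso s)⟩
  · have := rho_le_of_spanning_of_small hG hs hr0 (by rwa [← hr]) e hom
    linarith
end Spanning

end SpectralFactor

theorem corollary6p5 {V : Type*} [Fintype V] (G : SimpleGraph V) (hG : G.Connected)
    (n : ℕ) (hn : 3 ≤ n) (hV : Fintype.card V = n) :
    ((7 ≤ n ∨ n = 3 ∨ n = 5) →
      SpectralFactor.rho (SpectralFactor.pendantGraph n) ≤ SpectralFactor.rho G →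
      ¬ Nonempty (G ≃g SpectralFactor.pendantGraph n) →
      ∀ v : V, SpectralFactor.HasFactor (SpectralFactor.deleteVertex G v)
        SpectralFactor.edgeOrCycle) ∧
    ((n = 4 ∨ n = 6) →
      SpectralFactor.rho (SpectralFactor.balancedGraph (n / 2)) ≤ SpectralFactor.rho G →
      ¬ Nonempty (G ≃g SpectralFactor.balancedGraph (n / 2)) →
      ∀ v : V, SpectralFactor.HasFactor (SpectralFactor.deleteVertex G v)
        SpectralFactor.edgeOrCycle) := by
  have key (v : V) (h : ¬ SpectralFactor.HasFactor (SpectralFactor.deleteVertex G v)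
      SpectralFactor.edgeOrCycle) : ∃ s r : ℕ, 1 ≤ s ∧ n = 2 * s + r ∧
      ∃ e : V ≃ Fin s ⊕ (Fin r ⊕ Fin s),
        ∀ a b, G.Adj a b → (SpectralFactor.extremalGraph s r).Adj (e a) (e b) := by
    obtain ⟨T, I, hT, hTI, hdisj, hN⟩ := SpectralFactor.exists_disjoint_of_not_hasFactor h
    obtain ⟨hle, e, he⟩ := SpectralFactor.exists_spanning_extremalGraph hTI hdisj hN
    exact ⟨_, _, hT, by omega, e, he⟩
  constructor
  · intro hn' hρ hiso v
    by_contra h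
    obtain ⟨s, r, hs, hr, e, hom⟩ := key v h
    exact hiso (SpectralFactor.nonempty_iso_pendantGraph hG hs hr hn' e hom hρ)
  · intro hn' hρ hiso v
    by_contra h
    obtain ⟨s, r, hs, hr, e, hom⟩ := key v h
    exact hiso (SpectralFactor.nonempty_iso_balancedGraph hG hs hr hn' e hom hρ)
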